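/- Proposition 3.6 (factorization of the optimal map). Let $X$ and $Y$ be smooth manifolds without boundary of dimensions $m\ge n$, with $Y$ connected, smoothly embedded in larger smooth manifolds $M$ and $N$ in which their closures $\overline X$ and $\overline Y$ are compact. Let $\mu$ and $\nu$ be Borel probability measures on $X$ and $Y$. Let the cost $c$ be of class $C^2$ on a neighbourhood of $\overline X\times\overline Y$ in $M\times N$. Assume the following. (a) $c$ is twisted: for every $x\in X$ the map $y\mapsto D_xc(x,y)$ is injective on $\overline Y$. (b) $\mu(A)=0$ for every Borel set $A\subseteq X$ of Hausdorff dimension at most $m-1$. (c) For $x\in X$ and $y\in Y$ the level set $L_x(y)=\{\bar x\in X: D_yc(\bar x,y)=D_yc(x,y)\}$ is connected and independent of $y$; it is then denoted by $L_x$. Let $Z=X/\!\sim$, where $x\sim\bar x$ if and only if $\bar x\in L_x$, let $Q:X\to Z$ be the quotient map, give $Z$ the quotient $\sigma$-algebra, and let $\alpha=Q_\#\mu$. Fix $y_0\in Y$. Then there is exactly one function $b:Z\times Y\to\mathbb R$, differentiable in $y$, with $$D_yb(z,y)=D_yc(x,y)\quad\text{for all } z\in Z,\ y\in Y,\ x\in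 Q^{-1}(z),\qquad b(z,y_0)=0\quad\text{for all } z\in Z.$$ Moreover, let $F:X\to Y$ be an optimal map for $\mu$ and $\nu$, that is, a Borel map with $F_\#\mu=\nu$ that minimizes $\int_X c(x,G(x))\,d\mu(x)$ among all Borel maps $G:X\to Y$ with $G_\#\mu=\nu$. Then there is a measurable map $T:Z\to Y$ such that $F=T\circ Q$ $\mu$-almost everywhere, and $T$ solves Monge's problem on $Z\times Y$ with cost $b$ and marginals $\alpha$ and $\nu$: $T_\#\alpha=\nu$, and $T$ minimizes $\int_Z b(z,G(z))\,d\alpha(z)$ among all measurable maps $G:Z\to Y$ with $G_\#\alpha=\nu$. -/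

import Mathlib

open Set MeasureTheory Function
open scoped Manifold ContDiff ENNReal

namespace LeafTransport

noncomputable section

/-- The differential in the first variable, a covector at `x`. The second variable may range over
any set. -/
def dFst {m : ℕ} {X W : Type*} [TopologicalSpace X] [ChartedSpace (EuclideanSpace ℝ (Fin m)) X]
    (c : X → W → ℝ) (x : X) (w : W) : TangentSpace (𝓡 m) x →L[ℝ] ℝ :=
  mfderiv (𝓡 m) 𝓘(ℝ, ℝ) (fun x' => c x' w) x

/-- The differential in the second variable, a covector at `y`. The first variable may range over
any set. -/
def dSnd {n : ℕ} {W Y : Type*} [TopologicalSpace Y] [ChartedSpace (EuclideanSpace ℝ (Fin n)) Y]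
    (c : W → Y → ℝ) (w : W) (y : Y) : TangentSpace (𝓡 n) y →L[ℝ] ℝ :=
  mfderiv (𝓡 n) 𝓘(ℝ, ℝ) (fun y' => c w y') y

/-- The twist condition: for every `x`, the map `w ↦ D_x c(x, w)` is injective on `S`. -/
def IsTwistedOn {m : ℕ} {X W : Type*} [TopologicalSpace X]
    [ChartedSpace (EuclideanSpace ℝ (Fin m)) X] (c : X → W → ℝ) (S : Set W) : Prop :=
  ∀ x : X, InjOn (fun w => dFst (m := m) c x w) S

/-- The level set `L_x(y) = {x' | D_y c(x', y) = D_y c(x, y)}`. -/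
def levelSet {n : ℕ} {X Y : Type*} [TopologicalSpace Y]
    [ChartedSpace (EuclideanSpace ℝ (Fin n)) Y] (c : X → Y → ℝ) (x : X) (y : Y) : Set X :=
  {x' | dSnd (n := n) c x' y = dSnd (n := n) c x y}

/-- The equivalence relation `x ∼ x' ↔ x' ∈ L_x(y₀)`. When `L_x(y)` does not depend on `y`, neither
does this relation depend on `y₀`. -/
def leafSetoid {n : ℕ} {X Y : Type*} [TopologicalSpace Y]
    [ChartedSpace (EuclideanSpace ℝ (Fin n)) Y] (c : X → Y → ℝ) (y₀ : Y) : Setoid X where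
  r x x' := x' ∈ levelSet (n := n) c x y₀
  iseqv :=
    { refl := fun _ => rfl
      symm := fun h => Eq.symm h
      trans := fun h h' => Eq.trans h' h }

/-- The leaf space `Z = X / ∼`. It carries the quotient σ-algebra: `B ⊆ Z` is measurable iff its
preimage in `X` is Borel. (The leaves are the fibres of `x ↦ D_y c(x, y₀)`; when this map is
continuous and `X` is a second countable Hausdorff manifold, this σ-algebra is the Borel σ-algebra
of the quotient topology, and also that of the image `D_y c(X, y₀)`.) -/
abbrev LeafSpace {n : ℕ} {X Y : Type*} [TopologicalSpace Y]
    [ChartedSpace (EuclideanSpace ℝ (Fin n)) Y] (c : X → Y → ℝ) (y₀ : Y) : Type _ :=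
  Quotient (leafSetoid (n := n) c y₀)

/-- The quotient map `Q : X → Z`. -/
def leafMap {n : ℕ} {X Y : Type*} [TopologicalSpace Y]
    [ChartedSpace (EuclideanSpace ℝ (Fin n)) Y] (c : X → Y → ℝ) (y₀ : Y) (x : X) :
    LeafSpace (n := n) c y₀ :=
  Quotient.mk (leafSetoid (n := n) c y₀) x

/-- `b : Z × Y → ℝ` is the reduced cost: `D_y b(z, y) = D_y c(x, y)` for all `x ∈ Q⁻¹(z)` and all
`y`, and `b(z, y₀) = 0` for all `z`. -/
def IsLeafCost {n : ℕ} {X Y : Type*} [TopologicalSpace Y]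
    [ChartedSpace (EuclideanSpace ℝ (Fin n)) Y] (c : X → Y → ℝ) (y₀ : Y)
    (b : LeafSpace (n := n) c y₀ → Y → ℝ) : Prop :=
  (∀ (z : LeafSpace (n := n) c y₀) (y : Y), MDifferentiableAt (𝓡 n) 𝓘(ℝ, ℝ) (b z) y ∧
    ∀ x : X, leafMap (n := n) c y₀ x = z → dSnd (n := n) b z y = dSnd (n := n) c x y) ∧
  ∀ z : LeafSpace (n := n) c y₀, b z y₀ = 0

/-- The Hausdorff dimension of a subset of a manifold, computed in the preferred charts. Transition
maps are locally bi-Lipschitz, so for a second countable manifold this is the Hausdorff dimension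
with respect to any Riemannian distance. -/
def manifoldDimH (m : ℕ) {X : Type*} [TopologicalSpace X]
    [ChartedSpace (EuclideanSpace ℝ (Fin m)) X] (A : Set X) : ℝ≥0∞ :=
  ⨆ x : X, dimH ((chartAt (EuclideanSpace ℝ (Fin m)) x) ''
    (A ∩ (chartAt (EuclideanSpace ℝ (Fin m)) x).source))

/-- `F` is measurable and pushes `μ` forward to `ν`. -/
def IsTransportMap {X Y : Type*} [MeasurableSpace X] [MeasurableSpace Y]
    (μ : Measure X) (ν : Measure Y) (F : X → Y) : Prop :=
  Measurable F ∧ μ.map F = ν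

/-- `F` solves Monge's problem with cost `c` and marginals `μ`, `ν`: it has a finite total cost, and
that is minimal among all transport maps (of finite total cost). -/
def IsOptimalMap {X Y : Type*} [MeasurableSpace X] [MeasurableSpace Y]
    (c : X → Y → ℝ) (μ : Measure X) (ν : Measure Y) (F : X → Y) : Prop :=
  IsTransportMap μ ν F ∧ Integrable (fun x => c x (F x)) μ ∧
    ∀ G : X → Y, IsTransportMap μ ν G → Integrable (fun x => c x (G x)) μ →
      ∫ x, c x (F x) ∂μ ≤ ∫ x, c x (G x) ∂μ

end

end LeafTransport

namespace LeafTransport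

open Filter Topology

/-! Write `g x y` for `c (i x) (j y)`. If `x` and `x'` lie in one leaf, then `g x - g x'` has zero
differential on the connected manifold `Y`, hence is constant. This forces `b (Q x) y = g x y - g x
y₀` (`isLeafCost_iff`). It also shows that the two-point inequality `g x y + g x' y' ≤ g x y' + g x'
y` survives moving `x` and `x'` inside their leaves.

The graph of an optimal `F` satisfies this inequality over a set of full measure: otherwise,
exchanging the targets of two small sets of equal mass would lower the cost
(`IsOptimalMap.exists_monotone`). Its saturation along the leaves is therefore monotone too. For a
twisted cost, the points with two partners in a monotone set lie on countably many Lipschitz graphs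
over hyperplanes, so they are `μ`-null (`measure_setOf_exists_ne_eq_zero`). Two points of one leaf
with different values of `F` would each have two partners in the saturation; hence, off a null set,
`F` is constant on leaves.

`exists_measurable_ae_eq_comp` makes this factorization measurable. Finally, the costs on `X` and on
the leaf space differ by `∫ g x y₀`, which is the same for all competitors, so optimality descends.
-/

/-! ### Locally compact second countable Hausdorff spaces are Polish -/

/-- A dense embedding of a locally compact space into a Hausdorff space is open. -/
theorem isOpen_range_of_locallyCompact {X Y : Type*} [TopologicalSpace X] [TopologicalSpace Y]
    [LocallyCompactSpace X] [T2Space Y] {f : X → Y} (hf : IsEmbedding f) (hd : DenseRange f) :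
    IsOpen (range f) := by
  rw [isOpen_iff_mem_nhds]
  rintro _ ⟨x, rfl⟩
  obtain ⟨K, hK, hxK⟩ := exists_compact_mem_nhds x
  rw [hf.nhds_eq_comap, mem_comap] at hxK
  obtain ⟨V, hV, hVK⟩ := hxK
  obtain ⟨W, hWV, hW, hxW⟩ := mem_nhds_iff.1 hV
  refine mem_of_superset (hW.mem_nhds hxW) ?_
  -- The points of the range in `W` are dense in `W` and lie in `f '' K`, which is compact, hence
  -- closed.
  have h1 : W ⊆ closure (f '' K) := by
    refine (hd.open_subset_closure_inter hW).trans (closure_mono ?_)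
    rintro _ ⟨hw, a, rfl⟩
    exact ⟨a, hVK (hWV hw), rfl⟩
  rw [(hK.image hf.continuous).isClosed.closure_eq] at h1
  exact h1.trans (image_subset_range _ _)

/-- A second countable locally compact Hausdorff space is Polish. -/
theorem polishSpace_of_locallyCompact (X : Type*) [TopologicalSpace X] [LocallyCompactSpace X]
    [T2Space X] [SecondCountableTopology X] : PolishSpace X := by
  let := TopologicalSpace.metrizableSpaceMetric X
  have he : IsEmbedding ((↑) : X → UniformSpace.Completion X) :=
    UniformSpace.Completion.isUniformEmbedding_coe X |>.isEmbedding
  have ho := isOpen_range_of_locallyCompact he UniformSpace.Completion.denseRange_coe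
  have : PolishSpace (UniformSpace.Completion X) := inferInstance
  have := ho.polishSpace
  exact he.toHomeomorph.isClosedEmbedding.polishSpace

/-! ### Rearrangements of atomless measures -/

/-- Every atomless probability measure on a standard Borel space is carried to the uniform measure
on the unit interval by a measurable map. -/
theorem exists_measurable_map_eq_uniform {X : Type*} [MeasurableSpace X] [StandardBorelSpace X]
    (ρ : Measure X) [IsProbabilityMeasure ρ] [NullSingletonClass ρ] :
    ∃ f : X → unitInterval, Measurable f ∧ ρ.map f = volume := by
  have he := measurableEmbedding_embeddingReal X
  set e := embeddingReal X
  set τ := ρ.map e with hτ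
  have : IsProbabilityMeasure τ := Measure.isProbabilityMeasure_map he.measurable.aemeasurable
  have hna : NullSingletonClass τ := by
    refine ⟨fun x => ?_⟩
    rw [hτ, Measure.map_apply he.measurable (measurableSet_singleton x)]
    exact (subsingleton_singleton.preimage he.injective).measure_zero ρ
  have hcont : Continuous (ProbabilityTheory.cdf τ) := by
    rw [continuous_iff_continuousAt]
    intro a
    have h := (ProbabilityTheory.cdf τ).measure_singleton a
    rw [ProbabilityTheory.measure_cdf, measure_singleton] at h
    have h1 := ENNReal.ofReal_eq_zero.1 h.symm
    have h2 := (ProbabilityTheory.cdf τ).mono.leftLim_le (le_refl a)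
    rw [(ProbabilityTheory.cdf τ).mono.continuousAt_iff_leftLim_eq_rightLim,
      StieltjesFunction.rightLim_eq]
    linarith
  set G : ℝ → unitInterval := fun x =>
    ⟨ProbabilityTheory.cdf τ x, ProbabilityTheory.cdf_nonneg τ x, ProbabilityTheory.cdf_le_one τ x⟩
  have hG : Continuous G := by fun_prop
  -- The continuous cdf takes the value `t` at some `a`, and `{G < t} ⊆ Iic a ⊆ {G ≤ t}`. The
  -- endpoints are excluded because the cdf need not attain 0 and 1.
  have hval : ∀ t : unitInterval, 0 < t → t < 1 →
      ENNReal.ofReal t ≤ τ (G ⁻¹' Iic t) ∧ τ (G ⁻¹' Iio t) ≤ ENNReal.ofReal t := by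
    intro t ht0 ht1
    obtain ⟨a, ha⟩ : (t : ℝ) ∈ range (ProbabilityTheory.cdf τ) :=
      mem_range_of_exists_le_of_exists_ge hcont
        ((ProbabilityTheory.tendsto_cdf_atBot τ).eventually_le_const
          (show (0 : ℝ) < t from ht0)).exists
        ((ProbabilityTheory.tendsto_cdf_atTop τ).eventually_const_le
          (show (t : ℝ) < 1 from ht1)).exists
    rw [← ha, ProbabilityTheory.ofReal_cdf]
    constructor
    · refine measure_mono fun x hx => ?_
      have := (ProbabilityTheory.monotone_cdf τ) hx
      rw [ha] at this
      exact this
    · refine measure_mono fun x hx => ?_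
      by_contra hax
      have := (ProbabilityTheory.monotone_cdf τ) (not_le.1 hax).le
      rw [ha] at this
      exact absurd (show (ProbabilityTheory.cdf τ x) < t from hx) (not_lt.2 this)
  refine ⟨G ∘ e, hG.measurable.comp he.measurable, ?_⟩
  rw [← Measure.map_map hG.measurable he.measurable, ← hτ]
  have : IsProbabilityMeasure (τ.map G) :=
    Measure.isProbabilityMeasure_map hG.measurable.aemeasurable
  refine Measure.ext_of_Iic _ _ fun t => ?_
  rw [Measure.map_apply hG.measurable measurableSet_Iic, unitInterval.volume_Iic]
  apply le_antisymm
  -- The upper bound comes from `{G ≤ t} ⊆ {G < t + ε}`.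
  · refine ENNReal.le_of_forall_pos_le_add fun ε hε _ => ?_
    have hadd : ENNReal.ofReal ((t : ℝ) + ε) = ENNReal.ofReal t + ε := by
      rw [ENNReal.ofReal_add (unitInterval.nonneg t) ε.coe_nonneg, ENNReal.ofReal_coe_nnreal]
    by_cases h : (t : ℝ) + ε < 1
    · have h0 : (0 : ℝ) < t + ε := add_pos_of_nonneg_of_pos t.2.1 hε
      have := (hval ⟨t + ε, h0.le, h.le⟩ h0 h).2
      refine le_trans (measure_mono ?_) (this.trans_eq hadd)
      intro x hx
      exact lt_of_le_of_lt (show G x ≤ t from hx)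
        (show (t : ℝ) < t + ε by linarith [show (0 : ℝ) < ε from hε])
    · calc τ (G ⁻¹' Iic t) ≤ 1 := prob_le_one
        _ = ENNReal.ofReal 1 := by simp
        _ ≤ ENNReal.ofReal (t + ε) := ENNReal.ofReal_le_ofReal (not_lt.1 h)
        _ = _ := hadd
  · rcases eq_or_lt_of_le (show (0 : unitInterval) ≤ t from t.2.1) with h0 | h0
    · simp [← h0]
    rcases eq_or_lt_of_le (show t ≤ 1 from t.2.2) with h1 | h1
    · have : G ⁻¹' Iic t = univ := by
        ext x
        simpa [h1] using unitInterval.le_one' (t := G x)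
      rw [this, h1]
      simp
    · exact (hval t h0 h1).1

/-- The uniform measure is an intermediate stop: `ρ` is carried to it, and it is carried to any `τ`.
-/
theorem exists_measurable_map_eq {X Y : Type*} [MeasurableSpace X] [StandardBorelSpace X]
    [MeasurableSpace Y] [StandardBorelSpace Y]
    (ρ : Measure X) [IsProbabilityMeasure ρ] [NullSingletonClass ρ] (τ : Measure Y) [IsProbabilityMeasure τ] :
    ∃ f : X → Y, Measurable f ∧ ρ.map f = τ := by
  obtain ⟨f, hf, hfρ⟩ := exists_measurable_map_eq_uniform ρ
  have : Nonempty Y := nonempty_of_isProbabilityMeasure τ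
  obtain ⟨g, hg, hgτ⟩ := τ.exists_measurable_map_eq
  exact ⟨g ∘ f, hg.comp hf, by rw [← Measure.map_map hg hf, hfρ, hgτ]⟩

theorem exists_measurable_map_restrict_eq {X : Type*} [MeasurableSpace X] [StandardBorelSpace X]
    (μ : Measure X) [IsFiniteMeasure μ] [NullSingletonClass μ] {A B : Set X} (h : μ A = μ B) (h0 : μ A ≠ 0) :
    ∃ f : X → X, Measurable f ∧ (μ.restrict A).map f = μ.restrict B := by
  have key : ∀ C : Set X, μ C = μ A → IsProbabilityMeasure ((μ A)⁻¹ • μ.restrict C) := by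
    intro C hC
    refine ⟨?_⟩
    rw [Measure.smul_apply, Measure.restrict_apply_univ, hC, smul_eq_mul,
      ENNReal.inv_mul_cancel h0 (measure_ne_top μ A)]
  have := key A rfl
  have := key B h.symm
  have : NullSingletonClass ((μ A)⁻¹ • μ.restrict A) := ⟨fun x => by simp⟩
  obtain ⟨f, hf, hfe⟩ := exists_measurable_map_eq ((μ A)⁻¹ • μ.restrict A) ((μ A)⁻¹ • μ.restrict B)
  refine ⟨f, hf, ?_⟩
  have h2 := congrArg (fun τ => μ A • τ) hfe
  simp only [Measure.map_smul, smul_smul] at h2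
  rwa [ENNReal.mul_inv_cancel h0 (measure_ne_top μ A), one_smul, one_smul] at h2

/-- Atomless finite measures on standard Borel spaces have the intermediate value property. -/
theorem exists_measurable_subset_measure_eq {X : Type*} [MeasurableSpace X] [StandardBorelSpace X]
    (μ : Measure X) [IsFiniteMeasure μ] [NullSingletonClass μ] {A : Set X} (hA : MeasurableSet A)
    {s : ℝ≥0∞} (hs : s ≤ μ A) : ∃ B ⊆ A, MeasurableSet B ∧ μ B = s := by
  rcases eq_or_ne (μ A) 0 with h0 | h0
  · exact ⟨A, Subset.rfl, hA, le_antisymm (by simp [h0]) hs⟩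
  have hp : IsProbabilityMeasure ((μ A)⁻¹ • μ.restrict A) := by
    refine ⟨?_⟩
    rw [Measure.smul_apply, Measure.restrict_apply_univ, smul_eq_mul,
      ENNReal.inv_mul_cancel h0 (measure_ne_top μ A)]
  have : NullSingletonClass ((μ A)⁻¹ • μ.restrict A) := ⟨fun x => by simp⟩
  obtain ⟨f, hf, hfe⟩ := exists_measurable_map_eq_uniform ((μ A)⁻¹ • μ.restrict A)
  have htop := measure_ne_top μ A
  have hr : s / μ A ≤ 1 := ENNReal.div_le_of_le_mul (by simpa using hs)
  have hr' : s / μ A ≠ ⊤ := (hr.trans_lt ENNReal.one_lt_top).ne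
  let t : unitInterval := ⟨(s / μ A).toReal, ENNReal.toReal_nonneg,
    by simpa using ENNReal.toReal_mono ENNReal.one_ne_top hr⟩
  have h := congrArg (fun τ => τ (Iic t)) hfe
  simp only [unitInterval.volume_Iic] at h
  rw [Measure.map_apply hf measurableSet_Iic, Measure.smul_apply,
    Measure.restrict_apply (hf measurableSet_Iic), ENNReal.ofReal_toReal hr', smul_eq_mul] at h
  refine ⟨f ⁻¹' Iic t ∩ A, inter_subset_right, (hf measurableSet_Iic).inter hA, ?_⟩
  have h2 := congrArg (fun r => μ A * r) h
  simp only [← mul_assoc] at h2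
  rwa [ENNReal.mul_inv_cancel h0 htop, one_mul, ENNReal.mul_div_cancel h0 htop] at h2

/-- In an atomless finite measure space, equally large parts of two disjoint sets of positive
measure can be exchanged by a measure preserving map. -/
theorem exists_measurePreserving_swap {X : Type*} [MeasurableSpace X] [StandardBorelSpace X]
    (μ : Measure X) [IsFiniteMeasure μ] [NullSingletonClass μ] {A A' : Set X} (hA : MeasurableSet A)
    (hA' : MeasurableSet A') (hd : Disjoint A A') (h0 : μ A ≠ 0) (h0' : μ A' ≠ 0) :
    ∃ B ⊆ A, ∃ B' ⊆ A', MeasurableSet B ∧ MeasurableSet B' ∧ μ B = μ B' ∧ μ B ≠ 0 ∧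
      ∃ σ : X → X, MeasurePreserving σ μ μ ∧ (∀ᵐ x ∂μ, x ∈ B → σ x ∈ B') ∧
        (∀ᵐ x ∂μ, x ∈ B' → σ x ∈ B) ∧ ∀ x, x ∉ B → x ∉ B' → σ x = x := by
  classical
  obtain ⟨B, hBA, hB, hBm⟩ := exists_measurable_subset_measure_eq μ hA (min_le_left (μ A) (μ A'))
  obtain ⟨B', hBA', hB', hBm'⟩ :=
    exists_measurable_subset_measure_eq μ hA' (min_le_right (μ A) (μ A'))
  have hm : μ B = μ B' := hBm.trans hBm'.symm
  have hB0 : μ B ≠ 0 := by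
    rw [hBm]; exact (lt_min h0.bot_lt h0'.bot_lt).ne'
  have hBB : Disjoint B B' := hd.mono hBA hBA'
  obtain ⟨f, hf, hfe⟩ := exists_measurable_map_restrict_eq μ hm hB0
  obtain ⟨f', hf', hfe'⟩ := exists_measurable_map_restrict_eq μ hm.symm (hm ▸ hB0)
  have hae : ∀ {C D : Set X} {k : X → X}, MeasurableSet C → MeasurableSet D → Measurable k →
      (μ.restrict C).map k = μ.restrict D → ∀ᵐ x ∂μ, x ∈ C → k x ∈ D := by
    intro C D k hC hD hk hkm
    rw [← ae_restrict_iff' hC]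
    have : ∀ᵐ y ∂(μ.restrict C).map k, y ∈ D := by
      rw [hkm]; exact ae_restrict_mem hD
    exact ae_of_ae_map hk.aemeasurable this
  -- The maps `f` and `f'` need not be inverse to each other; only their pushforwards matter.
  set σ : X → X := B.piecewise f (B'.piecewise f' id) with hσ
  have hσm : Measurable σ := hf.piecewise hB (hf'.piecewise hB' measurable_id)
  refine ⟨B, hBA, B', hBA', hB, hB', hm, hB0, σ, ⟨hσm, ?_⟩, ?_, ?_, ?_⟩
  · have hsplit : μ = μ.restrict B + (μ.restrict B' + μ.restrict (B ∪ B')ᶜ) := by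
      rw [← add_assoc, ← Measure.restrict_union hBB hB',
        Measure.restrict_add_restrict_compl (hB.union hB')]
    have e1 : (μ.restrict B).map σ = μ.restrict B' := by
      rw [← hfe]
      refine Measure.map_congr ?_
      filter_upwards [ae_restrict_mem hB] with x hx
      simp [hσ, hx]
    have e2 : (μ.restrict B').map σ = μ.restrict B := by
      rw [← hfe']
      refine Measure.map_congr ?_
      filter_upwards [ae_restrict_mem hB'] with x hx
      simp [hσ, hx, hBB.notMem_of_mem_right hx]
    have e3 : (μ.restrict (B ∪ B')ᶜ).map σ = μ.restrict (B ∪ B')ᶜ := by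
      conv_rhs => rw [← Measure.map_id (μ := μ.restrict (B ∪ B')ᶜ)]
      refine Measure.map_congr ?_
      filter_upwards [ae_restrict_mem (hB.union hB').compl] with x hx
      simp only [mem_compl_iff, mem_union, not_or] at hx
      simp [hσ, hx.1, hx.2]
    conv_lhs => rw [hsplit]
    rw [Measure.map_add _ _ hσm, Measure.map_add _ _ hσm, e1, e2, e3]
    conv_rhs => rw [hsplit]
    rw [← add_assoc, ← add_assoc, add_comm (μ.restrict B')]
  · filter_upwards [hae hB hB' hf hfe] with x hx hxB
    simpa [hσ, hxB] using hx hxB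
  · filter_upwards [hae hB' hB hf' hfe'] with x hx hxB
    simpa [hσ, hxB, hBB.notMem_of_mem_right hxB] using hx hxB
  · intro x h h'
    simp [hσ, h, h']

/-! ### Monotonicity of optimal maps -/

section Monotone

variable {X Y : Type*} [TopologicalSpace X] [MeasurableSpace X]
  [BorelSpace X] [TopologicalSpace Y] [SecondCountableTopology Y] [MeasurableSpace Y]
  [BorelSpace Y] {g : X → Y → ℝ}

theorem integrable_of_bounded (hg : Continuous (uncurry g)) (hb : ∃ K, ∀ x y, |g x y| ≤ K)
    {μ : Measure X} [IsFiniteMeasure μ] {G : X → Y} (hG : Measurable G) :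
    Integrable (fun x => g x (G x)) μ := by
  obtain ⟨K, hK⟩ := hb
  have : Measurable fun x => g x (G x) := hg.measurable.comp (measurable_id.prodMk hG)
  exact Integrable.of_bound this.aestronglyMeasurable K (ae_of_all _ fun x => hK x _)

/-- The graph of an optimal map over a set of full measure is monotone: exchanging two targets does
not lower the cost. -/
theorem IsOptimalMap.exists_monotone [T2Space X] [SecondCountableTopology X] [StandardBorelSpace X]
    (hg : Continuous (uncurry g)) (hb : ∃ K, ∀ x y, |g x y| ≤ K)
    {μ : Measure X} [IsProbabilityMeasure μ] [NullSingletonClass μ] {ν : Measure Y} {F : X → Y}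
    (hF : IsOptimalMap g μ ν F) :
    ∃ S : Set X, (∀ᵐ x ∂μ, x ∈ S) ∧
      ∀ x ∈ S, ∀ x' ∈ S, g x (F x) + g x' (F x') ≤ g x (F x') + g x' (F x) := by
  obtain ⟨⟨hFm, hFν⟩, -, hmin⟩ := hF
  have hgr : Measurable fun x => (x, F x) := measurable_id.prodMk hFm
  -- At a point of the support, every neighbourhood of `(x, F x)` carries mass of the graph, so
  -- there is mass available to exchange.
  refine ⟨{x | (x, F x) ∈ (μ.map fun x => (x, F x)).support},
    ae_of_ae_map hgr.aemeasurable Measure.support_mem_ae, fun x hx x' hx' => ?_⟩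
  by_contra! hlt
  have hne : x ≠ x' := by
    rintro rfl
    linarith
  -- Four values of `g` are replaced by nearby ones at a loss of at most `ε` each, which leaves a
  -- gain of at least `8 * ε - 4 * ε` times `μ B`.
  set ε := (g x (F x) + g x' (F x') - (g x (F x') + g x' (F x))) / 8 with hε
  have hε0 : 0 < ε := by rw [hε]; linarith
  have near : ∀ a b, ∃ U ∈ 𝓝 a, ∃ V ∈ 𝓝 b, ∀ s ∈ U, ∀ t ∈ V, |g s t - g a b| < ε := by
    intro a b
    have : ∀ᶠ p in 𝓝 (a, b), |uncurry g p - uncurry g (a, b)| < ε := by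
      have := (Metric.continuous_iff'.1 hg) (a, b) ε hε0
      simpa [Real.dist_eq] using this
    rw [nhds_prod_eq, eventually_prod_iff] at this
    obtain ⟨P, hP, P', hP', h⟩ := this
    exact ⟨_, hP, _, hP', fun s hs t ht => h hs ht⟩
  obtain ⟨U₁, hU₁, V₁, hV₁, h₁⟩ := near x (F x)
  obtain ⟨U₂, hU₂, V₂, hV₂, h₂⟩ := near x (F x')
  obtain ⟨U₃, hU₃, V₃, hV₃, h₃⟩ := near x' (F x)
  obtain ⟨U₄, hU₄, V₄, hV₄, h₄⟩ := near x' (F x')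
  obtain ⟨W, W', hW, hW', hxW, hxW', hWW⟩ := t2_separation hne
  obtain ⟨U, hUs, hU, hxU⟩ := mem_nhds_iff.1
    (inter_mem (inter_mem hU₁ hU₂) (hW.mem_nhds hxW))
  obtain ⟨U', hUs', hU', hxU'⟩ := mem_nhds_iff.1
    (inter_mem (inter_mem hU₃ hU₄) (hW'.mem_nhds hxW'))
  obtain ⟨V, hVs, hV, hxV⟩ := mem_nhds_iff.1 (inter_mem hV₁ hV₃)
  obtain ⟨V', hVs', hV', hxV'⟩ := mem_nhds_iff.1 (inter_mem hV₂ hV₄)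
  have pos : ∀ (a : X) (s : Set X) (t : Set Y), (a, F a) ∈ (μ.map fun x => (x, F x)).support →
      IsOpen s → IsOpen t → a ∈ s → F a ∈ t → μ (s ∩ F ⁻¹' t) ≠ 0 := by
    intro a s t ha hs ht has hat
    have h := (Measure.mem_support_iff_forall _).1 ha (s ×ˢ t)
      (prod_mem_nhds (hs.mem_nhds has) (ht.mem_nhds hat))
    rw [Measure.map_apply hgr (hs.measurableSet.prod ht.measurableSet)] at h
    exact h.ne'
  obtain ⟨B, hBA, B', hBA', hB, hB', hm, hB0, σ, hσ, hσB, hσB', hσid⟩ :=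
    exists_measurePreserving_swap μ (hU.measurableSet.inter (hFm hV.measurableSet))
      (hU'.measurableSet.inter (hFm hV'.measurableSet))
      ((hWW.mono (fun a ha => (hUs ha).2) (fun a ha => (hUs' ha).2)).mono
        inter_subset_left inter_subset_left)
      (pos x U V hx hU hV hxU hxV) (pos x' U' V' hx' hU' hV' hxU' hxV')
  have hG : Measurable (F ∘ σ) := hFm.comp hσ.measurable
  have hi := integrable_of_bounded hg hb (μ := μ) hFm
  have hi' := integrable_of_bounded hg hb (μ := μ) hG
  have hle := hmin (F ∘ σ) ⟨hG, by rw [← Measure.map_map hFm hσ.measurable, hσ.map_eq, hFν]⟩ hi'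
  have hlow : ∀ᵐ a ∂μ, B.indicator (fun _ => g x (F x) - g x (F x') - 2 * ε) a +
      B'.indicator (fun _ => g x' (F x') - g x' (F x) - 2 * ε) a ≤
        g a (F a) - g a ((F ∘ σ) a) := by
    have hBB : Disjoint B B' := (hWW.mono (fun a ha => (hUs ha).2) (fun a ha => (hUs' ha).2)).mono
      (hBA.trans inter_subset_left) (hBA'.trans inter_subset_left)
    filter_upwards [hσB, hσB'] with a ha ha'
    by_cases haB : a ∈ B
    · have haB' := hBB.notMem_of_mem_left haB
      have e₁ := abs_lt.1 (h₁ a (hUs (hBA haB).1).1.1 (F a) (hVs (hBA haB).2).1)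
      have e₂ := abs_lt.1 (h₂ a (hUs (hBA haB).1).1.2 (F (σ a)) (hVs' (hBA' (ha haB)).2).1)
      simp only [haB, haB', indicator_of_mem, indicator_of_notMem, not_false_eq_true, comp_apply]
      linarith [e₁.1, e₂.2]
    · by_cases haB' : a ∈ B'
      · have e₁ := abs_lt.1 (h₄ a (hUs' (hBA' haB').1).1.2 (F a) (hVs' (hBA' haB').2).2)
        have e₂ := abs_lt.1 (h₃ a (hUs' (hBA' haB').1).1.1 (F (σ a)) (hVs (hBA (ha' haB')).2).2)
        simp only [haB, haB', indicator_of_mem, indicator_of_notMem, not_false_eq_true, comp_apply]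
        linarith [e₁.1, e₂.2]
      · simp [haB, haB', hσid a haB haB']
  have hint := integral_mono_ae
    (((integrable_const _).indicator hB).add ((integrable_const _).indicator hB'))
    (hi.sub hi') hlow
  simp only [Pi.sub_apply] at hint
  rw [integral_sub hi hi', integral_add ((integrable_const _).indicator hB)
    ((integrable_const _).indicator hB'), integral_indicator_const _ hB,
    integral_indicator_const _ hB', measureReal_def, measureReal_def, ← hm] at hint
  have hBpos : 0 < (μ B).toReal := ENNReal.toReal_pos hB0 (measure_ne_top μ B)
  simp only [smul_eq_mul] at hint
  have : 0 < (μ B).toReal * (4 * ε) := by positivity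
  have h8 : g x (F x) + g x' (F x') - (g x (F x') + g x' (F x)) = 8 * ε := by rw [hε]; ring
  nlinarith

end Monotone

/-! ### Twisted costs and sets of codimension one -/

/-- A set of a finite-dimensional space on which a nonzero functional is a contraction is the graph
of a Lipschitz function over a hyperplane, so it has codimension at least one. -/
theorem dimH_add_one_le_of_abs_mul_le {E : Type*} [NormedAddCommGroup E] [NormedSpace ℝ E]
    [FiniteDimensional ℝ E] {p : E →L[ℝ] ℝ} {e : E} (he : p e = 1) {s : Set E}
    (hs : ∀ u ∈ s, ∀ v ∈ s, |p (u - v)| * ‖e‖ ≤ 1 / 2 * ‖u - v‖) :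
    dimH s + 1 ≤ Module.finrank ℝ E := by
  set K := LinearMap.ker (p : E →ₗ[ℝ] ℝ) with hK
  have hrank : Module.finrank ℝ K + 1 = Module.finrank ℝ E := by
    have h := LinearMap.finrank_range_add_finrank_ker (p : E →ₗ[ℝ] ℝ)
    have hr : LinearMap.range (p : E →ₗ[ℝ] ℝ) = ⊤ := by
      rw [LinearMap.range_eq_top]
      exact fun r => ⟨r • e, by simp [he]⟩
    rw [hr, finrank_top, Module.finrank_self] at h
    rw [hK, ← h, add_comm]
  -- The projection onto the kernel along `e`. By `hs` the discarded component is at most half of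
  -- the distance, whence the constant 2.
  let P : s → K := fun u => ⟨(u : E) - p u • e, by simp [hK, he]⟩
  have hP : AntilipschitzWith 2 P := by
    refine AntilipschitzWith.of_le_mul_dist fun u v => ?_
    have hd : dist (P u) (P v) = ‖((u : E) - v) - p (u - v) • e‖ := by
      rw [Subtype.dist_eq, dist_eq_norm]
      congr 1
      simp only [P, map_sub, sub_smul]
      abel
    have h1 := hs u u.2 v v.2
    have h2 : ‖((u : E) - v)‖ ≤ ‖((u : E) - v) - p (u - v) • e‖ + |p (u - v)| * ‖e‖ := by
      rw [← Real.norm_eq_abs, ← norm_smul]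
      simpa using norm_add_le (((u : E) - v) - p (u - v) • e) (p (u - v) • e)
    rw [Subtype.dist_eq, dist_eq_norm, hd]
    push_cast
    linarith
  have h1 : dimH s = dimH (univ : Set s) := by
    rw [← (isometry_subtype_coe (s := s)).dimH_image univ, image_univ, Subtype.range_coe]
  have h2 : dimH s ≤ Module.finrank ℝ K := by
    rw [h1, ← Real.dimH_univ_eq_finrank K]
    exact (hP.le_dimH_image univ).trans (dimH_mono (subset_univ _))
  rw [← hrank]
  push_cast
  gcongr

section Manifold

variable {m n : ℕ} {X Y : Type*}
  [TopologicalSpace X] [ChartedSpace (EuclideanSpace ℝ (Fin m)) X]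
  [TopologicalSpace Y] [ChartedSpace (EuclideanSpace ℝ (Fin n)) Y]

/-- The dimension of a subset of a manifold is at most that of any set containing its image in a
chart whose domain contains it. -/
theorem manifoldDimH_le_of_mapsTo_chart [IsManifold (𝓡 m) 1 X] {x : X} {A : Set X}
    {D : Set (EuclideanSpace ℝ (Fin m))}
    (hA : A ⊆ (chartAt (EuclideanSpace ℝ (Fin m)) x).source)
    (hD : MapsTo (chartAt (EuclideanSpace ℝ (Fin m)) x) A D) :
    manifoldDimH m A ≤ dimH D := by
  refine iSup_le fun z => ?_
  set ψ := chartAt (EuclideanSpace ℝ (Fin m)) x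
  set χ := chartAt (EuclideanSpace ℝ (Fin m)) z
  have hτ : ContDiffOn ℝ 1 (χ ∘ ψ.symm) (ψ.symm.trans χ).source := by
    have h := contDiffOn_ext_coord_change (I := 𝓡 m) (n := 1) z x
    simpa only [mfld_simps] using h
  have hopen := (ψ.symm.trans χ).open_source
  have hsub : χ '' (A ∩ χ.source) ⊆ (χ ∘ ψ.symm) '' (D ∩ (ψ.symm.trans χ).source) := by
    rintro _ ⟨a, ⟨haA, haχ⟩, rfl⟩
    refine ⟨ψ a, ⟨hD haA, ?_⟩, by simp [ψ.left_inv (hA haA)]⟩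
    simp [ψ.map_source (hA haA), ψ.left_inv (hA haA), haχ]
  refine (dimH_mono hsub).trans ((dimH_image_le_of_locally_lipschitzOn ?_).trans
    (dimH_mono inter_subset_left))
  intro u hu
  obtain ⟨C, t, ht, hL⟩ := ((hτ u hu.2).contDiffAt (hopen.mem_nhds hu.2)).exists_lipschitzOnWith
  exact ⟨C, t, mem_nhdsWithin_of_mem_nhds ht, hL⟩

/-- The inequality is a closed condition, so it extends to the closure of the image of `A` in the
chart. The preimage of that closure is a Borel set of codimension one, so `A` itself need not be
measurable. -/
theorem measure_eq_zero_of_abs_mul_le [IsManifold (𝓡 m) 1 X] [MeasurableSpace X] [BorelSpace X]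
    {μ : Measure X}
    (hμ : ∀ A : Set X, MeasurableSet A → manifoldDimH m A + 1 ≤ m → μ A = 0) {x : X} {A : Set X}
    (hA : A ⊆ (chartAt (EuclideanSpace ℝ (Fin m)) x).source)
    {p : EuclideanSpace ℝ (Fin m) →L[ℝ] ℝ} {e : EuclideanSpace ℝ (Fin m)} (he : p e = 1)
    (h : ∀ a ∈ A, ∀ b ∈ A,
      |p (chartAt (EuclideanSpace ℝ (Fin m)) x a - chartAt (EuclideanSpace ℝ (Fin m)) x b)| * ‖e‖ ≤
        1 / 2 * ‖chartAt (EuclideanSpace ℝ (Fin m)) x a -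
          chartAt (EuclideanSpace ℝ (Fin m)) x b‖) :
    μ A = 0 := by
  set ψ := chartAt (EuclideanSpace ℝ (Fin m)) x
  set D := closure (ψ '' A) with hD
  have hDp : ∀ u ∈ D, ∀ v ∈ D, |p (u - v)| * ‖e‖ ≤ 1 / 2 * ‖u - v‖ := by
    have hcl : IsClosed {q : EuclideanSpace ℝ (Fin m) × EuclideanSpace ℝ (Fin m) |
        |p (q.1 - q.2)| * ‖e‖ ≤ 1 / 2 * ‖q.1 - q.2‖} :=
      isClosed_le (by fun_prop) (by fun_prop)
    have hsub := closure_minimal (s := (ψ '' A) ×ˢ (ψ '' A)) (by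
      rintro ⟨_, _⟩ ⟨⟨a, ha, rfl⟩, ⟨b, hb, rfl⟩⟩
      exact h a ha b hb) hcl
    rw [closure_prod_eq] at hsub
    exact fun u hu v hv => hsub (mk_mem_prod hu hv)
  have hmeas : MeasurableSet (ψ.source ∩ ψ ⁻¹' D) := by
    have hO := ψ.isOpen_inter_preimage (isClosed_closure (s := ψ '' A)).isOpen_compl
    convert ψ.open_source.measurableSet.diff hO.measurableSet using 1
    ext a
    by_cases ha : a ∈ ψ.source <;> simp [ha, hD]
  refine measure_mono_null (t := ψ.source ∩ ψ ⁻¹' D)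
    (fun a ha => ⟨hA ha, subset_closure (mem_image_of_mem _ ha)⟩) (hμ _ hmeas ?_)
  have h1 := manifoldDimH_le_of_mapsTo_chart (x := x) (A := ψ.source ∩ ψ ⁻¹' D) (D := D)
    inter_subset_left (fun a ha => ha.2)
  have h2 := dimH_add_one_le_of_abs_mul_le he hDp
  rw [finrank_euclideanSpace_fin] at h2
  exact (add_le_add_left h1 1).trans h2

/-- A `C¹` function of two variables has a first-order expansion in the first variable which is
uniform in the second one. -/
theorem exists_nhds_abs_sub_le {g : X → Y → ℝ} {x : X} {y : Y}
    (hg : ContMDiffAt ((𝓡 m).prod (𝓡 n)) 𝓘(ℝ, ℝ) 1 (uncurry g) (x, y)) {ε : ℝ} (hε : 0 < ε) :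
    ∃ U ∈ 𝓝 x, ∃ V ∈ 𝓝 y, ∀ a ∈ U, ∀ b ∈ U, ∀ w ∈ V,
      |g a w - g b w - (dFst (m := m) g x y : EuclideanSpace ℝ (Fin m) →L[ℝ] ℝ)
        (chartAt (EuclideanSpace ℝ (Fin m)) x a - chartAt (EuclideanSpace ℝ (Fin m)) x b)| ≤
      ε * ‖chartAt (EuclideanSpace ℝ (Fin m)) x a - chartAt (EuclideanSpace ℝ (Fin m)) x b‖ := by
  set ψ := chartAt (EuclideanSpace ℝ (Fin m)) x with hψ
  set χ := chartAt (EuclideanSpace ℝ (Fin n)) y with hχ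
  set G : EuclideanSpace ℝ (Fin m) × EuclideanSpace ℝ (Fin n) → ℝ :=
    fun q => g (ψ.symm q.1) (χ.symm q.2) with hG
  have hGd : ContDiffAt ℝ 1 G (ψ x, χ y) := by
    have h := (contMDiffAt_iff.1 hg).2
    simp only [mfld_simps, Prod.map_id, range_id, contDiffWithinAt_univ] at h
    exact h
  -- Strict differentiability compares any two points near `(ψ x, χ y)`. Choosing them with the same
  -- second coordinate leaves only the first partial derivative and makes the estimate uniform in
  -- `w`.
  have hS := hGd.hasStrictFDerivAt one_ne_zero
  set G' := fderiv ℝ G (ψ x, χ y)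
  have hp : (dFst (m := m) g x y : EuclideanSpace ℝ (Fin m) →L[ℝ] ℝ) =
      G'.comp (ContinuousLinearMap.inl ℝ _ _) := by
    have hmd : MDifferentiableAt (𝓡 m) 𝓘(ℝ, ℝ) (fun x' => g x' y) x := by
      have h1 : ContMDiffAt (𝓡 m) ((𝓡 m).prod (𝓡 n)) 1 (fun x' : X => (x', y)) x :=
        contMDiffAt_id.prodMk contMDiffAt_const
      exact (ContMDiffAt.comp x hg h1).mdifferentiableAt one_ne_zero
    have h2 : HasFDerivAt (fun u => g (ψ.symm u) y)
        (G'.comp (ContinuousLinearMap.inl ℝ _ _)) (ψ x) := by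
      have h3 : (fun u => g (ψ.symm u) y) = fun u => G (u, χ y) := by
        ext u
        simp [hG, hχ]
      rw [h3]
      exact hS.hasFDerivAt.comp (ψ x) (hasFDerivAt_prodMk_left (𝕜 := ℝ) (ψ x) (χ y))
    unfold dFst
    rw [hmd.mfderiv]
    simp only [mfld_simps, fderivWithin_univ]
    exact h2.fderiv
  have hO := hS.isLittleO.def hε
  rw [nhds_prod_eq] at hO
  obtain ⟨T, hT, hTp⟩ := mem_prod_same_iff.1 hO
  rw [nhds_prod_eq, mem_prod_iff] at hT
  obtain ⟨T₁, hT₁, T₂, hT₂, hTT⟩ := hT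
  refine ⟨ψ.source ∩ ψ ⁻¹' T₁, inter_mem (chart_source_mem_nhds _ x)
    ((ψ.continuousAt (mem_chart_source _ x)) hT₁), χ.source ∩ χ ⁻¹' T₂,
    inter_mem (chart_source_mem_nhds _ y) ((χ.continuousAt (mem_chart_source _ y)) hT₂), ?_⟩
  intro a ha b hb w hw
  have hT' : ∀ z ∈ ψ.source ∩ ψ ⁻¹' T₁, (ψ z, χ w) ∈ T := fun z hz => hTT (mk_mem_prod hz.2 hw.2)
  have h : ‖G (ψ a, χ w) - G (ψ b, χ w) - G' ((ψ a, χ w) - (ψ b, χ w))‖ ≤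
      ε * ‖(ψ a, χ w) - (ψ b, χ w)‖ :=
    hTp (mk_mem_prod (hT' a ha) (hT' b hb))
  rw [hp]
  change |g a w - g b w - G' (ψ a - ψ b, 0)| ≤ ε * ‖ψ a - ψ b‖
  simpa [hG, ψ.left_inv ha.1, ψ.left_inv hb.1, χ.left_inv hw.1, Prod.norm_def] using h

/-- For a twisted cost, the set of points with several partners in a monotone set is null for
measures that do not charge sets of codimension one. -/
theorem measure_setOf_exists_ne_eq_zero [IsManifold (𝓡 m) 1 X] [SecondCountableTopology X]
    [SecondCountableTopology Y] [MeasurableSpace X] [BorelSpace X] {g : X → Y → ℝ}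
    (hg : ContMDiff ((𝓡 m).prod (𝓡 n)) 𝓘(ℝ, ℝ) 1 (uncurry g)) (htw : IsTwistedOn (m := m) g univ)
    {μ : Measure X}
    (hμ : ∀ A : Set X, MeasurableSet A → manifoldDimH m A + 1 ≤ m → μ A = 0) {Γ : Set (X × Y)}
    (hΓ : ∀ q ∈ Γ, ∀ q' ∈ Γ, g q.1 q.2 + g q'.1 q'.2 ≤ g q.1 q'.2 + g q'.1 q.2) :
    μ {x | ∃ y y', y ≠ y' ∧ (x, y) ∈ Γ ∧ (x, y') ∈ Γ} = 0 := by
  have loc : ∀ t : {t : X × Y × Y // t.2.1 ≠ t.2.2}, ∃ U ∈ 𝓝 t.1.1, ∃ V ∈ 𝓝 t.1.2.1,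
      ∃ V' ∈ 𝓝 t.1.2.2, μ {x | x ∈ U ∧ ∃ y ∈ V, ∃ y' ∈ V', (x, y) ∈ Γ ∧ (x, y') ∈ Γ} = 0 := by
    rintro ⟨⟨x, y₁, y₂⟩, hne⟩
    set p₁ : EuclideanSpace ℝ (Fin m) →L[ℝ] ℝ := dFst (m := m) g x y₁
    set p₂ : EuclideanSpace ℝ (Fin m) →L[ℝ] ℝ := dFst (m := m) g x y₂
    have hpne : p₁ - p₂ ≠ 0 :=
      sub_ne_zero.2 fun h => hne (htw x (mem_univ _) (mem_univ _) h)
    obtain ⟨e, he⟩ : ∃ e, (p₁ - p₂) e = 1 := by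
      obtain ⟨v, hv⟩ := DFunLike.ne_iff.1 hpne
      exact ⟨((p₁ - p₂) v)⁻¹ • v, by
        rw [map_smul, smul_eq_mul, inv_mul_cancel₀ (by simpa using hv)]⟩
    -- Chosen so that twice this number times `‖e‖` is at most `1 / 2`, the contraction factor
    -- required above.
    have hε : 0 < 1 / (4 * (‖e‖ + 1)) := by positivity
    obtain ⟨U₁, hU₁, V₁, hV₁, h₁⟩ := exists_nhds_abs_sub_le (hg (x, y₁)) hε
    obtain ⟨U₂, hU₂, V₂, hV₂, h₂⟩ := exists_nhds_abs_sub_le (hg (x, y₂)) hε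
    refine ⟨U₁ ∩ U₂ ∩ (chartAt (EuclideanSpace ℝ (Fin m)) x).source,
      inter_mem (inter_mem hU₁ hU₂) (chart_source_mem_nhds _ x), V₁, hV₁, V₂, hV₂,
      measure_eq_zero_of_abs_mul_le hμ (fun a ha => ha.1.2) he ?_⟩
    set ψ := chartAt (EuclideanSpace ℝ (Fin m)) x
    -- Monotonicity reads `g a y - g b y ≤ g a y' - g b y'`; the left side is expanded with `p₁`,
    -- the right side with `p₂`. Since `a` and `b` both have partners in `V₁` and in `V₂`, their
    -- roles can be interchanged, which bounds the absolute value.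
    have key : ∀ a b, a ∈ U₁ ∩ U₂ → b ∈ U₁ ∩ U₂ → ∀ y ∈ V₁, ∀ y' ∈ V₂, (a, y) ∈ Γ → (b, y') ∈ Γ →
        (p₁ - p₂) (ψ a - ψ b) ≤ 2 * (1 / (4 * (‖e‖ + 1)) * ‖ψ a - ψ b‖) := by
      intro a b ha hb y hy y' hy' hay hby
      have e₁ : -(1 / (4 * (‖e‖ + 1)) * ‖ψ a - ψ b‖) ≤ g a y - g b y - p₁ (ψ a - ψ b) :=
        (abs_le.1 (h₁ a ha.1 b hb.1 y hy)).1
      have e₂ : g a y' - g b y' - p₂ (ψ a - ψ b) ≤ 1 / (4 * (‖e‖ + 1)) * ‖ψ a - ψ b‖ :=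
        (abs_le.1 (h₂ a ha.2 b hb.2 y' hy')).2
      have e₃ := hΓ _ hay _ hby
      rw [sub_apply]
      simp only at e₃
      linarith
    rintro a ⟨⟨haU, -⟩, y, hy, y', hy', hay, hay'⟩ b ⟨⟨hbU, -⟩, w, hw, w', hw', hbw, hbw'⟩
    have k₁ := key a b haU hbU y hy w' hw' hay hbw'
    have k₂ := key b a hbU haU w hw y' hy' hbw hay'
    rw [← neg_sub (ψ a), map_neg, norm_neg] at k₂
    have habs : |(p₁ - p₂) (ψ a - ψ b)| ≤ 2 * (1 / (4 * (‖e‖ + 1)) * ‖ψ a - ψ b‖) :=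
      abs_le.2 ⟨by linarith, k₁⟩
    have hfrac : 2 * (1 / (4 * (‖e‖ + 1))) * ‖e‖ ≤ 1 / 2 := by
      have : 0 < ‖e‖ + 1 := by positivity
      rw [show 2 * (1 / (4 * (‖e‖ + 1))) * ‖e‖ = ‖e‖ / (2 * (‖e‖ + 1)) by field_simp; ring,
        div_le_iff₀ (by positivity)]
      linarith
    calc |(p₁ - p₂) (ψ a - ψ b)| * ‖e‖
        ≤ 2 * (1 / (4 * (‖e‖ + 1)) * ‖ψ a - ψ b‖) * ‖e‖ := by gcongr
      _ = 2 * (1 / (4 * (‖e‖ + 1))) * ‖e‖ * ‖ψ a - ψ b‖ := by ring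
      _ ≤ 1 / 2 * ‖ψ a - ψ b‖ := by gcongr
  choose U hU V hV V' hV' hnull using loc
  have : SecondCountableTopology {t : X × Y × Y // t.2.1 ≠ t.2.2} :=
    TopologicalSpace.Subtype.secondCountableTopology {t : X × Y × Y | t.2.1 ≠ t.2.2}
  -- By second countability, countably many of the local neighbourhoods cover all triples with `y ≠
  -- y'`.
  obtain ⟨s, hs, hcov⟩ := TopologicalSpace.countable_cover_nhds
    (f := fun t : {t : X × Y × Y // t.2.1 ≠ t.2.2} => Subtype.val ⁻¹' (U t ×ˢ V t ×ˢ V' t))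
    fun t => continuous_subtype_val.continuousAt
      (prod_mem_nhds (hU t) (prod_mem_nhds (hV t) (hV' t)))
  refine measure_mono_null ?_ ((measure_biUnion_null_iff hs).2 fun t _ => hnull t)
  rintro x ⟨y, y', hne, hy, hy'⟩
  have hx : (⟨(x, y, y'), hne⟩ : {t : X × Y × Y // t.2.1 ≠ t.2.2}) ∈
      ⋃ t ∈ s, Subtype.val ⁻¹' (U t ×ˢ V t ×ˢ V' t) := hcov ▸ mem_univ _
  obtain ⟨t, ht, hxt⟩ := mem_iUnion₂.1 hx
  exact mem_iUnion₂.2 ⟨t, ht, hxt.1, y, hxt.2.1, y', hxt.2.2, hy, hy'⟩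

/-! ### The reduced cost -/

/-- A function with vanishing differential on a connected manifold is constant. -/
theorem eq_of_mfderiv_eq_zero [IsManifold (𝓡 n) 1 Y] [PreconnectedSpace Y] {h : Y → ℝ}
    (hd : ∀ y, HasMFDerivAt (𝓡 n) 𝓘(ℝ, ℝ) h y 0) (y y' : Y) : h y = h y' := by
  refine IsLocallyConstant.apply_eq_of_preconnectedSpace
    ((IsLocallyConstant.iff_eventually_eq h).2 fun y => ?_) y y'
  set χ := chartAt (EuclideanSpace ℝ (Fin n)) y with hχ
  obtain ⟨r, hr, hball⟩ := Metric.isOpen_iff.1 χ.open_target (χ y) (mem_chart_target _ y)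
  have hk : ∀ u ∈ Metric.ball (χ y) r, HasFDerivAt (h ∘ χ.symm) (0 : EuclideanSpace ℝ (Fin n) →L[ℝ] ℝ) u := by
    intro u hu
    have h1 : MDifferentiableAt (𝓡 n) (𝓡 n) χ.symm u :=
      mdifferentiableAt_atlas_symm (chart_mem_atlas _ y) (hball hu)
    have h2 := (hd (χ.symm u)).comp u h1.hasMFDerivAt
    rw [ContinuousLinearMap.zero_comp] at h2
    exact hasMFDerivAt_iff_hasFDerivAt.1 h2
  have hnhds : χ.source ∩ χ ⁻¹' Metric.ball (χ y) r ∈ 𝓝 y :=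
    inter_mem (chart_source_mem_nhds _ y)
      ((χ.continuousAt (mem_chart_source _ y)) (Metric.ball_mem_nhds _ hr))
  filter_upwards [hnhds] with w hw
  have := (convex_ball (χ y) r).is_const_of_fderivWithin_eq_zero (𝕜 := ℝ) (f := h ∘ χ.symm)
    (fun u hu => (hk u hu).differentiableAt.differentiableWithinAt)
    (fun u hu => (hk u hu).hasFDerivWithinAt.fderivWithin
      (Metric.isOpen_ball.uniqueDiffWithinAt hu)) hw.2 (Metric.mem_ball_self hr)
  rwa [comp_apply, comp_apply, χ.left_inv hw.1, χ.left_inv (mem_chart_source _ y)] at this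

end Manifold

/-- Two functions with the same differential on a connected manifold differ by a constant. -/
theorem sub_eq_sub_of_mfderiv_eq {n : ℕ} {Y : Type*} [TopologicalSpace Y]
    [ChartedSpace (EuclideanSpace ℝ (Fin n)) Y] [IsManifold (𝓡 n) 1 Y] [PreconnectedSpace Y]
    {f f' : Y → ℝ} (hf : ∀ y, MDifferentiableAt (𝓡 n) 𝓘(ℝ, ℝ) f y)
    (hf' : ∀ y, MDifferentiableAt (𝓡 n) 𝓘(ℝ, ℝ) f' y)
    (h : ∀ y, mfderiv (𝓡 n) 𝓘(ℝ, ℝ) f y = mfderiv (𝓡 n) 𝓘(ℝ, ℝ) f' y) (y y' : Y) :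
    f y - f y' = f' y - f' y' := by
  have key := eq_of_mfderiv_eq_zero (n := n) (h := f - f') (fun y => by
    have h1 := (hf y).hasMFDerivAt.sub (hf' y).hasMFDerivAt
    rw [h y] at h1
    exact h1.congr_mfderiv (sub_self (G := EuclideanSpace ℝ (Fin n) →L[ℝ] ℝ) _)) y y'
  simp only [Pi.sub_apply] at key
  linarith

section LeafCost

variable {n : ℕ} {X Y : Type*} [TopologicalSpace Y] [ChartedSpace (EuclideanSpace ℝ (Fin n)) Y]
  [IsManifold (𝓡 n) 1 Y] [PreconnectedSpace Y] {g : X → Y → ℝ} {y₀ : Y}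

/-- Independence of `y` upgrades equality of the differentials at `y₀` to equality on all of `Y`,
and connectedness integrates it. -/
theorem sub_eq_sub_of_mem_levelSet (hd : ∀ x y, MDifferentiableAt (𝓡 n) 𝓘(ℝ, ℝ) (g x) y)
    (hindep : ∀ (x : X) (y y' : Y), levelSet (n := n) g x y = levelSet (n := n) g x y')
    {x x' : X} (h : x' ∈ levelSet (n := n) g x y₀) (y y' : Y) :
    g x y - g x y' = g x' y - g x' y' :=
  sub_eq_sub_of_mfderiv_eq (hd x) (hd x')
    (fun w => Eq.symm (show x' ∈ levelSet (n := n) g x w from hindep x y₀ w ▸ h)) y y'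

/-- The reduced cost is `b (Q x) y = g x y - g x y₀`. -/
theorem isLeafCost_iff (hd : ∀ x y, MDifferentiableAt (𝓡 n) 𝓘(ℝ, ℝ) (g x) y)
    {b : LeafSpace (n := n) g y₀ → Y → ℝ} :
    IsLeafCost (n := n) g y₀ b ↔ ∀ x y, b (leafMap (n := n) g y₀ x) y = g x y - g x y₀ := by
  constructor
  · rintro ⟨hb, hb0⟩ x y
    have := sub_eq_sub_of_mfderiv_eq (fun y => (hb (leafMap (n := n) g y₀ x) y).1) (hd x)
      (fun y => (hb (leafMap (n := n) g y₀ x) y).2 x rfl) y y₀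
    rwa [hb0, sub_zero] at this
  · intro hb
    have hder : ∀ x y, HasMFDerivAt (𝓡 n) 𝓘(ℝ, ℝ) (b (leafMap (n := n) g y₀ x)) y
        (dSnd (n := n) g x y) := by
      intro x y
      have he : b (leafMap (n := n) g y₀ x) = g x - fun _ => g x y₀ := funext fun y => hb x y
      have h1 := (hd x y).hasMFDerivAt.sub (hasMFDerivAt_const (I := 𝓡 n) (g x y₀) y)
      rw [he]
      exact h1.congr_mfderiv (sub_zero (G := EuclideanSpace ℝ (Fin n) →L[ℝ] ℝ) _)
    refine ⟨fun z y => ?_, fun z => ?_⟩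
    · obtain ⟨x, rfl⟩ : ∃ x, leafMap (n := n) g y₀ x = z := Quotient.exists_rep z
      exact ⟨(hder x y).mdifferentiableAt, fun x' hx' => hx' ▸ (hder x' y).mfderiv⟩
    · obtain ⟨x, rfl⟩ : ∃ x, leafMap (n := n) g y₀ x = z := Quotient.exists_rep z
      rw [hb, sub_self]

theorem existsUnique_isLeafCost (hd : ∀ x y, MDifferentiableAt (𝓡 n) 𝓘(ℝ, ℝ) (g x) y)
    (hindep : ∀ (x : X) (y y' : Y), levelSet (n := n) g x y = levelSet (n := n) g x y') :
    ∃! b : LeafSpace (n := n) g y₀ → Y → ℝ, IsLeafCost (n := n) g y₀ b := by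
  refine ⟨Quotient.lift (fun x y => g x y - g x y₀) fun x x' h => funext fun y =>
    sub_eq_sub_of_mem_levelSet hd hindep h y y₀, (isLeafCost_iff hd).2 fun _ _ => rfl, ?_⟩
  intro b hb
  funext z y
  obtain ⟨x, rfl⟩ : ∃ x, leafMap (n := n) g y₀ x = z := Quotient.exists_rep z
  exact (isLeafCost_iff hd).1 hb x y

end LeafCost

/-! ### Descent to the leaf space -/

/-- An optimal map that factors through the leaf space is optimal there for the reduced cost. -/
theorem IsOptimalMap.leafSpace {n : ℕ} {X Y : Type*} [TopologicalSpace X] [MeasurableSpace X]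
    [BorelSpace X] [TopologicalSpace Y] [ChartedSpace (EuclideanSpace ℝ (Fin n)) Y]
    {g : X → Y → ℝ} {y₀ : Y} [SecondCountableTopology Y] [MeasurableSpace Y] [BorelSpace Y]
    (hg : Continuous (uncurry g)) (hbd : ∃ K, ∀ x y, |g x y| ≤ K)
    {b : LeafSpace (n := n) g y₀ → Y → ℝ}
    (hb : ∀ x y, b (leafMap (n := n) g y₀ x) y = g x y - g x y₀)
    {μ : Measure X} [IsProbabilityMeasure μ] {ν : Measure Y} {F : X → Y}
    (hF : IsOptimalMap g μ ν F) {T : LeafSpace (n := n) g y₀ → Y} (hT : Measurable T)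
    (hFT : F =ᵐ[μ] T ∘ leafMap (n := n) g y₀) :
    IsOptimalMap b (μ.map (leafMap (n := n) g y₀)) ν T := by
  obtain ⟨⟨hFm, hFν⟩, hFi, hmin⟩ := hF
  have hQ : Measurable (leafMap (n := n) g y₀) := measurable_quotient_mk''
  have hmeas : ∀ G : LeafSpace (n := n) g y₀ → Y, Measurable G → Measurable fun z => b z (G z) := by
    intro G hG
    refine measurable_from_quotient.2 ?_
    have h1 : Measurable fun x => g x (G (leafMap (n := n) g y₀ x)) - g x y₀ :=
      (hg.measurable.comp (measurable_id.prodMk (hG.comp hQ))).sub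
        (hg.measurable.comp (measurable_id.prodMk measurable_const))
    convert h1 using 1
    exact funext fun x => hb x _
  have hi : ∀ G : X → Y, Measurable G → Integrable (fun x => g x (G x)) μ :=
    fun G hG => integrable_of_bounded hg hbd hG
  have hi0 := hi (fun _ => y₀) measurable_const
  -- A competitor on the leaf space lifts to one on `X`, and the two costs differ by a constant
  -- independent of `G`.
  have hcost : ∀ G : LeafSpace (n := n) g y₀ → Y, Measurable G →
      ∫ z, b z (G z) ∂(μ.map (leafMap (n := n) g y₀)) =
        ∫ x, g x ((G ∘ leafMap (n := n) g y₀) x) ∂μ - ∫ x, g x y₀ ∂μ := by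
    intro G hG
    rw [integral_map hQ.aemeasurable (hmeas G hG).aestronglyMeasurable,
      ← integral_sub (hi _ (hG.comp hQ)) hi0]
    exact integral_congr_ae (ae_of_all _ fun x => hb x _)
  refine ⟨⟨hT, ?_⟩, ?_, fun G hG _ => ?_⟩
  · rw [Measure.map_map hT hQ, ← hFν]
    exact (Measure.map_congr hFT).symm
  · rw [integrable_map_measure (hmeas T hT).aestronglyMeasurable hQ.aemeasurable]
    exact ((hi _ (hT.comp hQ)).sub hi0).congr (ae_of_all _ fun x => (hb x _).symm)
  · rw [hcost T hT, hcost G hG.1]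
    have h1 : ∫ x, g x ((T ∘ leafMap (n := n) g y₀) x) ∂μ = ∫ x, g x (F x) ∂μ :=
      integral_congr_ae (hFT.mono fun x hx => by simp only [hx])
    have h2 := hmin (G ∘ leafMap (n := n) g y₀)
      ⟨hG.1.comp hQ, by rw [← Measure.map_map hG.1 hQ, hG.2]⟩ (hi _ (hG.1.comp hQ))
    rw [h1]
    exact sub_le_sub_right h2 _

/-- A measurable map that is constant on the fibres of `φ`, up to a null set, is almost everywhere a
measurable function of `φ`. -/
theorem exists_measurable_ae_eq_comp {X Y W : Type*} [MeasurableSpace X] [StandardBorelSpace X]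
    [MeasurableSpace Y] [StandardBorelSpace Y] [Nonempty Y] [MeasurableSpace W]
    [MeasurableSpace.CountablySeparated W] {φ : X → W} (hφ : Measurable φ) {F : X → Y}
    (hF : Measurable F) {μ : Measure X} {S : Set X} (hS : ∀ᵐ x ∂μ, x ∈ S)
    (h : ∀ x ∈ S, ∀ x' ∈ S, φ x = φ x' → F x = F x') :
    ∃ k : W → Y, Measurable k ∧ F =ᵐ[μ] k ∘ φ := by
  set S' := (toMeasurable μ Sᶜ)ᶜ with hS'
  have hSm : MeasurableSet S' := (measurableSet_toMeasurable _ _).compl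
  have hsub : S' ⊆ S := compl_subset_comm.1 (subset_toMeasurable μ Sᶜ)
  have hae : ∀ᵐ x ∂μ, x ∈ S' := by
    rw [ae_iff]
    change μ S'ᶜ = 0
    rw [hS', compl_compl, measure_toMeasurable]
    exact hS
  have := hSm.standardBorel
  set φ' : S' → range (S'.domRestrict φ) := rangeFactorization (S'.domRestrict φ)
  have : MeasurableSpace.CountablySeparated (range (S'.domRestrict φ)) :=
    MeasurableSpace.CountablySeparated.subtype_iff.2
      (HasCountableSeparatingOn.mono (fun _ => id) (subset_univ _))
  have hφ' : Measurable φ' := (hφ.comp measurable_subtype_coe).subtype_mk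
  have hsurj : Surjective φ' := rangeFactorization_surjective
  -- The section `surjInv` is arbitrary and need not be measurable; `l` does not depend on it
  -- because `F` is constant on the fibres in `S'`.
  let l : range (S'.domRestrict φ) → Y := fun w => F (surjInv hsurj w : S')
  have hl : l ∘ φ' = S'.domRestrict F := by
    funext x
    refine h _ (hsub (Subtype.mem _)) _ (hsub x.2) ?_
    exact congrArg Subtype.val (surjInv_eq hsurj (φ' x))
  have hlm : Measurable l := by
    intro B hB
    -- For a measurable surjection from a standard Borel space onto a countably separated one, a set
    -- is measurable as soon as its preimage is.
    rw [← hφ'.measurableSet_preimage_iff_of_surjective hsurj, ← preimage_comp, hl]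
    exact (hF.comp measurable_subtype_coe) hB
  -- The range may fail to be measurable in `W`, but it carries the trace σ-algebra, so `l` still
  -- extends measurably to `W`.
  obtain ⟨k, hk, hlk⟩ := hlm.exists_eq_measurable_comp (f := Subtype.val)
  refine ⟨k, hk, ?_⟩
  filter_upwards [hae] with x hx
  have h1 := congrFun hl ⟨x, hx⟩
  rw [hlk] at h1
  exact h1.symm

/-- A connected manifold of dimension zero is a point. -/
theorem subsingleton_of_dim_eq_zero {Y : Type*} [TopologicalSpace Y]
    [ChartedSpace (EuclideanSpace ℝ (Fin 0)) Y] [PreconnectedSpace Y] : Subsingleton Y := by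
  have : DiscreteTopology Y := by
    refine discreteTopology_iff_isOpen_singleton.2 fun y => ?_
    set χ := chartAt (EuclideanSpace ℝ (Fin 0)) y
    have : χ.source = {y} := Subsingleton.eq_singleton_of_mem
      (fun a ha b hb => χ.injOn ha hb (Subsingleton.elim _ _)) (mem_chart_source _ y)
    exact this ▸ χ.open_source
  exact PreconnectedSpace.trivial_of_discrete

section Factor

variable {m n : ℕ} {X Y : Type*}
  [TopologicalSpace X] [ChartedSpace (EuclideanSpace ℝ (Fin m)) X] [IsManifold (𝓡 m) 1 X]
  [T2Space X] [SecondCountableTopology X] [MeasurableSpace X] [BorelSpace X]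
  [TopologicalSpace Y] [ChartedSpace (EuclideanSpace ℝ (Fin n)) Y] [IsManifold (𝓡 n) 1 Y]
  [T2Space Y] [SecondCountableTopology Y] [MeasurableSpace Y] [BorelSpace Y] [ConnectedSpace Y]
  {g : X → Y → ℝ} {y₀ : Y}

/-- The uniqueness of partners is applied to the leaf saturation of the graph of `F`, not to the
graph itself: this makes `F` constant on leaves off a null set. -/
theorem exists_measurable_ae_eq_comp_leafMap (hmn : n ≤ m)
    (hg : ContMDiff ((𝓡 m).prod (𝓡 n)) 𝓘(ℝ, ℝ) 1 (uncurry g)) (hbd : ∃ K, ∀ x y, |g x y| ≤ K)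
    (htw : IsTwistedOn (m := m) g univ)
    (hleaf : ∀ x x', x' ∈ levelSet (n := n) g x y₀ → ∀ y, g x y - g x y₀ = g x' y - g x' y₀)
    {μ : Measure X} [IsProbabilityMeasure μ] {ν : Measure Y}
    (hμ : ∀ A : Set X, MeasurableSet A → manifoldDimH m A + 1 ≤ m → μ A = 0)
    {F : X → Y} (hF : IsOptimalMap g μ ν F) :
    ∃ T : LeafSpace (n := n) g y₀ → Y, Measurable T ∧ F =ᵐ[μ] T ∘ leafMap (n := n) g y₀ := by
  -- For `m = 0` the condition on `μ` is void and atoms are possible, but then `Y` is a single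
  -- point.
  rcases Nat.eq_zero_or_pos m with rfl | hm
  · obtain rfl : n = 0 := Nat.le_zero.1 hmn
    have := subsingleton_of_dim_eq_zero (Y := Y)
    exact ⟨fun _ => y₀, measurable_const, ae_of_all _ fun x => Subsingleton.elim _ _⟩
  have := ChartedSpace.locallyCompactSpace (EuclideanSpace ℝ (Fin m)) X
  have := ChartedSpace.locallyCompactSpace (EuclideanSpace ℝ (Fin n)) Y
  have := polishSpace_of_locallyCompact X
  have := polishSpace_of_locallyCompact Y
  have : NullSingletonClass μ := by
    refine ⟨fun x => hμ _ (measurableSet_singleton x) ?_⟩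
    have h0 : manifoldDimH m ({x} : Set X) ≤ 0 := iSup_le fun z =>
      (dimH_subsingleton ((subsingleton_singleton.anti inter_subset_left).image _)).le
    calc manifoldDimH m ({x} : Set X) + 1 ≤ 0 + 1 := by gcongr
      _ ≤ m := by rw [zero_add]; exact_mod_cast hm
  obtain ⟨S, hS, hmono⟩ := hF.exists_monotone hg.continuous hbd
  -- The leaf relation enters through its consequence that the costs agree up to a constant; this is
  -- all that the monotonicity inequality sees.
  set Γ : Set (X × Y) := {q | ∃ x' ∈ S, (∀ w, g q.1 w - g q.1 y₀ = g x' w - g x' y₀) ∧ q.2 = F x'}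
  have hΓ : ∀ q ∈ Γ, ∀ q' ∈ Γ, g q.1 q.2 + g q'.1 q'.2 ≤ g q.1 q'.2 + g q'.1 q.2 := by
    rintro ⟨x, y⟩ ⟨a, ha, hxa, rfl⟩ ⟨x', y'⟩ ⟨a', ha', hxa', rfl⟩
    have := hmono a ha a' ha'
    simp only at hxa hxa' ⊢
    linarith [hxa (F a), hxa (F a'), hxa' (F a), hxa' (F a')]
  have hnull := measure_setOf_exists_ne_eq_zero hg htw hμ hΓ
  -- By continuity, the normalized cost on a dense sequence determines it on `Y`. Thus `φ` is
  -- constant on leaves and maps into a countably separated space, which the quotient σ-algebra is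
  -- not assumed to be.
  set φ : X → ℕ → ℝ := fun x k => g x (TopologicalSpace.denseSeq Y k) - g x y₀
  have hgc := hg.continuous
  have hφ : Measurable φ := by
    refine Continuous.measurable (continuous_pi fun k => ?_)
    exact (hgc.comp (continuous_id.prodMk continuous_const)).sub
      (hgc.comp (continuous_id.prodMk continuous_const))
  have hφeq : ∀ x x', φ x = φ x' → ∀ w, g x w - g x y₀ = g x' w - g x' y₀ := by
    intro x x' h
    have hcont : ∀ a, Continuous fun w => g a w - g a y₀ := fun a =>
      (hgc.comp (continuous_const.prodMk continuous_id)).sub continuous_const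
    refine congrFun ((TopologicalSpace.denseRange_denseSeq Y).equalizer (hcont x) (hcont x') ?_)
    exact funext fun k => congrFun h k
  obtain ⟨k, hk, hFk⟩ := exists_measurable_ae_eq_comp hφ hF.1.1
    (S := {x | x ∈ S ∧ x ∉ {x | ∃ y y', y ≠ y' ∧ (x, y) ∈ Γ ∧ (x, y') ∈ Γ}})
    (hS.and (measure_eq_zero_iff_ae_notMem.1 hnull)) (by
      rintro x ⟨hxS, hxN⟩ x' ⟨hxS', -⟩ hxx
      by_contra hne
      exact hxN ⟨F x, F x', hne, ⟨x, hxS, fun _ => rfl, rfl⟩, ⟨x', hxS', hφeq x x' hxx, rfl⟩⟩)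
  refine ⟨Quotient.lift (k ∘ φ) fun x x' h => ?_, measurable_from_quotient.2 (hk.comp hφ), hFk⟩
  exact congrArg k (funext fun i => hleaf x x' h _)

end Factor

end LeafTransport

theorem proposition3p6
    {m n m' n' : ℕ} (hmn : n ≤ m)
    -- the manifolds `X` and `Y` of dimensions `m` and `n`
    {X Y : Type*}
    [TopologicalSpace X] [ChartedSpace (EuclideanSpace ℝ (Fin m)) X] [IsManifold (𝓡 m) ∞ X]
    [MeasurableSpace X] [BorelSpace X]
    [TopologicalSpace Y] [ChartedSpace (EuclideanSpace ℝ (Fin n)) Y] [IsManifold (𝓡 n) ∞ Y]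
    [MeasurableSpace Y] [BorelSpace Y] [ConnectedSpace Y]
    -- the larger manifolds in which they are embedded with compact closures
    {M N : Type*}
    [TopologicalSpace M] [ChartedSpace (EuclideanSpace ℝ (Fin m')) M] [IsManifold (𝓡 m') ∞ M]
    [T2Space M] [SecondCountableTopology M]
    [TopologicalSpace N] [ChartedSpace (EuclideanSpace ℝ (Fin n')) N] [IsManifold (𝓡 n') ∞ N]
    [T2Space N] [SecondCountableTopology N]
    (i : X → M) (hi : Manifold.IsSmoothEmbedding (𝓡 m) (𝓡 m') ∞ i)
    (hiX : IsCompact (closure (range i)))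
    (j : Y → N) (hj : Manifold.IsSmoothEmbedding (𝓡 n) (𝓡 n') ∞ j)
    (hjY : IsCompact (closure (range j)))
    -- the cost, of class `C²` up to the closures
    (c : M → N → ℝ)
    (hc : ∀ p ∈ closure (range i) ×ˢ closure (range j),
      ContMDiffAt ((𝓡 m').prod (𝓡 n')) 𝓘(ℝ, ℝ) 2 (uncurry c) p)
    (htwist : LeafTransport.IsTwistedOn (m := m) (fun x w => c (i x) w) (closure (range j)))
    -- the level sets are connected and independent of `y`
    (hconn : ∀ (x : X) (y : Y),
      IsConnected (LeafTransport.levelSet (n := n) (fun x y => c (i x) (j y)) x y))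
    (hindep : ∀ (x : X) (y y' : Y),
      LeafTransport.levelSet (n := n) (fun x y => c (i x) (j y)) x y =
        LeafTransport.levelSet (n := n) (fun x y => c (i x) (j y)) x y')
    -- the marginals
    (μ : Measure X) [IsProbabilityMeasure μ] (ν : Measure Y) [IsProbabilityMeasure ν]
    (hμ : ∀ A : Set X, MeasurableSet A → LeafTransport.manifoldDimH m A + 1 ≤ m → μ A = 0)
    (y₀ : Y) :
    -- the reduced cost `b` is well defined
    (∃! b : LeafTransport.LeafSpace (n := n) (fun x y => c (i x) (j y)) y₀ → Y → ℝ,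
      LeafTransport.IsLeafCost (n := n) (fun x y => c (i x) (j y)) y₀ b) ∧
    ∀ b : LeafTransport.LeafSpace (n := n) (fun x y => c (i x) (j y)) y₀ → Y → ℝ,
      LeafTransport.IsLeafCost (n := n) (fun x y => c (i x) (j y)) y₀ b →
      ∀ F : X → Y, LeafTransport.IsOptimalMap (fun x y => c (i x) (j y)) μ ν F →
        ∃ T : LeafTransport.LeafSpace (n := n) (fun x y => c (i x) (j y)) y₀ → Y,
          F =ᵐ[μ] T ∘ LeafTransport.leafMap (n := n) (fun x y => c (i x) (j y)) y₀ ∧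
          LeafTransport.IsOptimalMap b
            (μ.map (LeafTransport.leafMap (n := n) (fun x y => c (i x) (j y)) y₀)) ν T := by
  have hiC : ContMDiff (𝓡 m) (𝓡 m') 1 i := hi.contMDiff.of_le (by norm_num)
  have hjC : ContMDiff (𝓡 n) (𝓡 n') 1 j := hj.contMDiff.of_le (by norm_num)
  have := hi.isEmbedding.t2Space
  have := hi.isEmbedding.secondCountableTopology
  have := hj.isEmbedding.t2Space
  have := hj.isEmbedding.secondCountableTopology
  have : IsManifold (𝓡 m) 1 X := .of_le (n := ∞) (by norm_num)
  have : IsManifold (𝓡 n) 1 Y := .of_le (n := ∞) (by norm_num)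
  have hmem : ∀ x y, (i x, j y) ∈ closure (range i) ×ˢ closure (range j) := fun x y =>
    mk_mem_prod (subset_closure (mem_range_self x)) (subset_closure (mem_range_self y))
  have hg : ContMDiff ((𝓡 m).prod (𝓡 n)) 𝓘(ℝ, ℝ) 1 (uncurry fun x y => c (i x) (j y)) := by
    rintro ⟨x, y⟩
    exact ContMDiffAt.comp (x, y) (g := uncurry c) (f := fun q : X × Y => (i q.1, j q.2))
      ((hc _ (hmem x y)).of_le (by norm_num))
      ((hiC.comp contMDiff_fst).prodMk (hjC.comp contMDiff_snd) (x, y))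
  -- Compactness of the closures bounds the cost, so every transport map has finite total cost.
  have hbd : ∃ K, ∀ x y, |c (i x) (j y)| ≤ K := by
    obtain ⟨K, hK⟩ := (hiX.prod hjY).exists_bound_of_continuousOn (f := uncurry c)
      fun p hp => (hc p hp).continuousAt.continuousWithinAt
    exact ⟨K, fun x y => hK _ (hmem x y)⟩
  have hd : ∀ x y, MDifferentiableAt (𝓡 n) 𝓘(ℝ, ℝ) (fun y => c (i x) (j y)) y := fun x y =>
    ((hg.comp (contMDiff_const.prodMk contMDiff_id : ContMDiff (𝓡 n) ((𝓡 m).prod (𝓡 n)) 1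
      fun y : Y => (x, y))) y).mdifferentiableAt one_ne_zero
  have htw : LeafTransport.IsTwistedOn (m := m) (fun x y => c (i x) (j y)) univ :=
    fun x y _ y' _ h => hj.isEmbedding.injective
      (htwist x (subset_closure (mem_range_self y)) (subset_closure (mem_range_self y')) h)
  refine ⟨LeafTransport.existsUnique_isLeafCost hd hindep, fun b hb F hF => ?_⟩
  obtain ⟨T, hT, hFT⟩ := LeafTransport.exists_measurable_ae_eq_comp_leafMap hmn hg hbd htw
    (fun x x' h y => LeafTransport.sub_eq_sub_of_mem_levelSet hd hindep h y y₀) hμ hF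
  exact ⟨T, hFT, hF.leafSpace hg.continuous hbd
    ((LeafTransport.isLeafCost_iff hd).1 hb) hT hFT⟩
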